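/- Let $n\ge 1$ be an integer, let $a<b$ be real, and let $L_2^n=L_2^n[a,b]$ be the real Hilbert space of square-integrable functions $[a,b]\to\mathbb{R}^n$. Let $D\subseteq L_2^n$ be a linear subspace (with the $L_2$-norm), let $\mathcal{T}:L_2^n\to D$ be a bounded linear bijection and let $\mathcal{A}:L_2^n\to L_2^n$ be a bounded linear operator. Define $A:=\mathcal{A}\circ\mathcal{T}^{-1}:D\to L_2^n$, and let $\omega\in\mathbb{R}$. Adjoints $\mathcal{T}^*,\mathcal{A}^*$ are taken with respect to the standard inner product of $L_2^n$, with $\mathcal{T}$ regarded as an operator $L_2^n\to L_2^n$. Suppose that 1. $\epsilon_1>0$ and $\mathcal{P}:L_2^n\to L_2^n$ is a bounded self-adjoint operator with $\mathcal{P}\succeq\epsilon_1^2 I$ (that is, $\langle x,\mathcal{P}x\rangle_{L_2}\ge\epsilon_1^2\|x\|_{L_2}^2$ for all $x\in L_2^n$) such that, with $\langle x,y\rangle_{\mathcal{P}}:=\langle x,\mathcal{P}y\rangle_{L_2}$, $$\langle \mathcal{T}v,\mathcal{A}v\rangle_{\mathcal{P}}\le\omega\,\langle \mathcal{T}v,\mathcal{T}v\rangle_{\mathcal{P}}\qquad\text{for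 all } v\in L_2^n;$$ 2. there exist $\epsilon_2>0$ and $\lambda>\omega$ such that $$\|(\lambda\mathcal{T}^*-\mathcal{A}^*)v\|_{L_2}\ge\epsilon_2\|v\|_{L_2}\qquad\text{for all } v\in L_2^n.$$ Then $A$, with domain $D$, is the infinitesimal generator of a $C_0$-semigroup $(S(t))_{t\ge 0}$ on $L_2^n$ with growth rate $\omega$ and gain $M:=\sqrt{\|\mathcal{P}\|}/\epsilon_1$, where $\|\cdot\|$ is the operator norm on $L_2^n$; that is, $M\ge 1$ and $\|S(t)\|\le M e^{\omega t}$ for all $t\ge 0$. -/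

import Mathlib

open Filter Topology MeasureTheory
open scoped NNReal

/-- The real Hilbert space `L₂ⁿ[a,b]` of (classes of) square-integrable functions
`[a,b] → ℝⁿ`, where `ℝⁿ` carries the Euclidean inner product. -/
abbrev L2 (n : ℕ) (a b : ℝ) : Type :=
  Lp (EuclideanSpace ℝ (Fin n)) 2 ((volume : Measure ℝ).restrict (Set.Icc a b))

section Semigroups

variable {H : Type*} [NormedAddCommGroup H] [InnerProductSpace ℝ H]

/-- The family `(S(t))_{t ≥ 0}` of bounded operators is a strongly continuous semigroup. -/
structure IsC0Semigroup (S : ℝ≥0 → H →L[ℝ] H) : Prop where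
  map_zero : S 0 = ContinuousLinearMap.id ℝ H
  map_add : ∀ t s : ℝ≥0, S (t + s) = (S t).comp (S s)
  tendsto_zero : ∀ x : H, Tendsto (fun t : ℝ≥0 => S t x) (𝓝[>] 0) (𝓝 x)

/-- The operator `A : D → H` (a linear map on a subspace `D = A.domain` of `H`) is the infinitesimal
generator of `S`: on `D` it is the right derivative of `S` at `0`, and `D` is the set of all
vectors at which this derivative exists. -/
structure IsInfinitesimalGenerator (A : H →ₗ.[ℝ] H) (S : ℝ≥0 → H →L[ℝ] H) : Prop where
  tendsto_apply : ∀ x : A.domain,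
    Tendsto (fun t : ℝ≥0 => (t : ℝ)⁻¹ • (S t (x : H) - (x : H))) (𝓝[>] 0) (𝓝 (A x))
  mem_domain : ∀ x y : H,
    Tendsto (fun t : ℝ≥0 => (t : ℝ)⁻¹ • (S t x - x)) (𝓝[>] 0) (𝓝 y) → x ∈ A.domain

/-- `S` has growth rate `ω` and gain `M ≥ 1`. -/
def HasGrowthRateGain (S : ℝ≥0 → H →L[ℝ] H) (ω M : ℝ) : Prop :=
  1 ≤ M ∧ ∀ t : ℝ≥0, ‖S t‖ ≤ M * Real.exp (ω * t)

/-- The weighted inner product `⟨x, y⟩_P = ⟨x, P y⟩`. -/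
def weightedInner (P : H →L[ℝ] H) (x y : H) : ℝ := inner ℝ x (P y)

/-- `P ⪰ c I`: the operator `P - c I` is self-adjoint and positive semidefinite. -/
def OpGeScalar (P : H →L[ℝ] H) (c : ℝ) : Prop :=
  (P - c • ContinuousLinearMap.id ℝ H).IsPositive

/-- The operator `A = 𝒜 ∘ T⁻¹ : D → H` for a bijection `T : H → D` onto a subspace `D` of `H`. -/
noncomputable def pieOperator {D : Submodule ℝ H} (T : H →L[ℝ] D) (hT : Function.Bijective T)
    (𝒜 : H →L[ℝ] H) : H →ₗ.[ℝ] H where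
  domain := D
  toFun := (𝒜 : H →ₗ[ℝ] H) ∘ₗ ((LinearEquiv.ofBijective (T : H →ₗ[ℝ] D) hT).symm : D →ₗ[ℝ] H)

end Semigroups

/-! Lumer–Phillips in an equivalent norm. Replacing `𝒜` by `𝒜 - ωT` turns `A` into `A - ω`,
dissipative for `⟨·,·⟩_P`; rescaling by `exp (ω t)` undoes the shift. The lower bound on the adjoint
makes `λT - 𝒜` surjective, dissipativity makes it injective, and a coercivity argument carries
invertibility to every `μ ≥ λ`. The resolvent of `A` is then `T(μT - 𝒜)⁻¹`, and `μ` times it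
contracts the `P`-norm. That norm lies between `ε₁‖x‖` and `√‖P‖ ‖x‖`, so all powers are bounded by
`M = √‖P‖/ε₁` in the original norm. Density of `D` also follows from dissipativity and surjectivity.
Hille–Yosida, proved by Yosida approximation, gives the semigroup with bound `M`. -/

section UniformlyBounded

variable {X : Type*} [NormedAddCommGroup X] [NormedSpace ℝ X]

theorem equicontinuous_of_opNorm_le {ι : Type*} {F : ι → X →L[ℝ] X} {M : ℝ}
    (hF : ∀ i, ‖F i‖ ≤ M) : Equicontinuous fun i x => F i x :=
  (LipschitzWith.uniformEquicontinuous _ M.toNNReal fun i =>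
    (F i).lipschitz.weaken (by
      rw [← NNReal.coe_le_coe, coe_nnnorm]
      exact (hF i).trans (Real.le_coe_toNNReal M))).equicontinuous

/-- Uniformly bounded operators converging strongly on a dense set to a bounded operator
do so everywhere. -/
theorem tendsto_apply_of_dense {ι : Type*} {l : Filter ι} {F : ι → X →L[ℝ] X} {M : ℝ}
    (hF : ∀ i, ‖F i‖ ≤ M) {s : Set X} (hs : Dense s) {G : X →L[ℝ] X}
    (h : ∀ x ∈ s, Tendsto (fun i => F i x) l (𝓝 (G x))) (x : X) :
    Tendsto (fun i => F i x) l (𝓝 (G x)) :=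
  (equicontinuous_of_opNorm_le hF x).tendsto_of_mem_closure
    (G.continuous.continuousAt.mono_left inf_le_left) h (hs x)

theorem tendsto_apply_apply {ι : Type*} {l : Filter ι} {F : ι → X →L[ℝ] X} {M : ℝ}
    (hF : ∀ i, ‖F i‖ ≤ M) {G : X →L[ℝ] X}
    (h : ∀ x, Tendsto (fun i => F i x) l (𝓝 (G x))) {u : ι → X} {x : X}
    (hu : Tendsto u l (𝓝 x)) : Tendsto (fun i => F i (u i)) l (𝓝 (G x)) := by
  have h1 : Tendsto (fun i => F i (u i - x)) l (𝓝 0) := by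
    refine squeeze_zero_norm (fun i => ContinuousLinearMap.le_of_opNorm_le _ (hF i) _) ?_
    simpa using ((hu.sub_const x).norm.const_mul M)
  simpa using h1.add (h x)

end UniformlyBounded

/-! ### Exponentials of power-bounded operators -/

section PowerBounded

variable {X : Type*} [NormedAddCommGroup X] [NormedSpace ℝ X] [CompleteSpace X]

theorem norm_exp_smul_le_of_norm_pow_le {J : X →L[ℝ] X} {M : ℝ} (hJ : ∀ n : ℕ, ‖J ^ n‖ ≤ M)
    {t : ℝ} (ht : 0 ≤ t) : ‖NormedSpace.exp (t • J)‖ ≤ M * Real.exp t := by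
  have h1 := NormedSpace.exp_series_hasSum_exp' (𝕂 := ℝ) (t • J)
  have h2 : HasSum (fun n : ℕ => M * ((n.factorial : ℝ)⁻¹ • t ^ n)) (M * Real.exp t) := by
    rw [Real.exp_eq_exp_ℝ]
    exact (NormedSpace.exp_series_hasSum_exp' (𝕂 := ℝ) t).mul_left M
  rw [← h1.tsum_eq]
  refine tsum_of_norm_bounded h2 fun n => ?_
  rw [smul_pow, norm_smul, norm_smul, Real.norm_of_nonneg (by positivity),
    Real.norm_of_nonneg (by positivity), smul_eq_mul, mul_comm M, mul_assoc]
  gcongr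
  exact hJ n

/-- The scalar factor `exp (-t)` exactly cancels the growth `exp t` of the series, so Yosida
semigroups are bounded uniformly in `μ`. -/
theorem norm_exp_smul_sub_one_le {J : X →L[ℝ] X} {M : ℝ} (hJ : ∀ n : ℕ, ‖J ^ n‖ ≤ M)
    {t : ℝ} (ht : 0 ≤ t) : ‖NormedSpace.exp (t • (J - 1))‖ ≤ M := by
  have h1 : t • (J - 1) = t • J + algebraMap ℝ (X →L[ℝ] X) (-t) := by
    rw [Algebra.algebraMap_eq_smul_one, smul_sub, neg_smul, sub_eq_add_neg]
  let _ : NormedAlgebra ℚ (X →L[ℝ] X) := NormedAlgebra.restrictScalars ℚ ℝ _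
  rw [h1, NormedSpace.exp_add_of_commute (Algebra.commutes _ _).symm,
    ← NormedSpace.algebraMap_exp_comm, ← Real.exp_eq_exp_ℝ, ← Algebra.commutes,
    Algebra.algebraMap_eq_smul_one, smul_mul_assoc, one_mul, norm_smul,
    Real.norm_of_nonneg (Real.exp_nonneg _)]
  calc Real.exp (-t) * ‖NormedSpace.exp (t • J)‖ ≤ Real.exp (-t) * (M * Real.exp t) := by
        gcongr
        exact norm_exp_smul_le_of_norm_pow_le hJ ht
    _ = M := by
        rw [mul_left_comm, ← Real.exp_add]
        simp

/-- Commuting generators of bounded uniformly continuous semigroups generate close orbits as soon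
as they take close values at the initial point. -/
theorem norm_exp_smul_apply_sub_le {B C : X →L[ℝ] X} (hBC : Commute B C) {M : ℝ}
    (hB : ∀ t : ℝ, 0 ≤ t → ‖NormedSpace.exp (t • B)‖ ≤ M)
    (hC : ∀ t : ℝ, 0 ≤ t → ‖NormedSpace.exp (t • C)‖ ≤ M) {t : ℝ} (ht : 0 ≤ t) (x : X) :
    ‖NormedSpace.exp (t • B) x - NormedSpace.exp (t • C) x‖ ≤ t * (M ^ 2 * ‖B x - C x‖) := by
  have hM : 0 ≤ M := (norm_nonneg _).trans (hB 0 le_rfl)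
  -- This path joins `exp (tC)` to `exp (tB)`; by commutation its derivative is `f s * (B - C)`.
  set f : ℝ → X →L[ℝ] X := fun s => NormedSpace.exp (s • B) * NormedSpace.exp ((t - s) • C)
  have hf : ∀ s, HasDerivAt f
      (NormedSpace.exp (s • B) * NormedSpace.exp ((t - s) • C) * (B - C)) s := by
    intro s
    have h1 := hasDerivAt_exp_smul_const (𝕂 := ℝ) B s
    have h2 := (hasDerivAt_exp_smul_const (𝕂 := ℝ) C (t - s)).scomp s
      ((hasDerivAt_id s).const_sub t)
    have h3 := h1.mul h2
    refine h3.congr_deriv ?_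
    have hc : Commute (NormedSpace.exp ((t - s) • C)) B := by
      exact (hBC.symm.smul_left (t - s)).exp_left
    simp only [Function.comp_def, neg_smul, one_smul, mul_neg, mul_sub, mul_assoc]
    rw [hc.eq]
    abel
  have hfx : ∀ s, HasDerivAt (fun s => f s x)
      ((NormedSpace.exp (s • B) * NormedSpace.exp ((t - s) • C) * (B - C)) x) s := fun s =>
    (hf s).clm_apply (hasDerivAt_const s x) |>.congr_deriv (by simp)
  have key := norm_image_sub_le_of_norm_deriv_le_segment' (f := fun s => f s x) (a := 0) (b := t)
    (C := M ^ 2 * ‖B x - C x‖) (fun s _ => (hfx s).hasDerivWithinAt) (fun s hs => ?_) t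
    ⟨ht, le_rfl⟩
  · simpa [f, mul_comm t] using key
  · calc _ = ‖NormedSpace.exp (s • B) (NormedSpace.exp ((t - s) • C) (B x - C x))‖ := by simp
      _ ≤ M * (M * ‖B x - C x‖) := by
        refine (ContinuousLinearMap.le_of_opNorm_le _ (hB s hs.1) _).trans ?_
        gcongr
        exact ContinuousLinearMap.le_of_opNorm_le _ (hC _ (by linarith [hs.2])) _
      _ = _ := by ring

/-- Uniformly bounded operators which are strongly Cauchy on a dense set converge strongly. -/
theorem exists_tendsto_of_dense {F : ℕ → X →L[ℝ] X} {M : ℝ}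
    (hF : ∀ i, ‖F i‖ ≤ M) {s : Set X} (hs : Dense s)
    (h : ∀ x ∈ s, CauchySeq fun i => F i x) :
    ∃ G : X →L[ℝ] X, ‖G‖ ≤ M ∧ ∀ x, Tendsto (fun i => F i x) atTop (𝓝 (G x)) := by
  have hM : 0 ≤ M := (norm_nonneg _).trans (hF 0)
  have hc : ∀ x, CauchySeq fun i => F i x := by
    intro x
    rw [Metric.cauchySeq_iff]
    intro ε hε
    obtain ⟨y, hy, hxy⟩ := hs.exists_dist_lt x (show 0 < ε / (3 * (M + 1)) by positivity)
    obtain ⟨N, hN⟩ := Metric.cauchySeq_iff.1 (h y hy) (ε / 3) (by positivity)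
    have hb : ∀ i, dist (F i x) (F i y) < ε / 3 := fun i => by
      rw [dist_eq_norm, ← map_sub]
      calc ‖F i (x - y)‖ ≤ M * ‖x - y‖ := ContinuousLinearMap.le_of_opNorm_le _ (hF i) _
        _ ≤ (M + 1) * ‖x - y‖ := by gcongr; linarith
        _ < (M + 1) * (ε / (3 * (M + 1))) := by
          rw [← dist_eq_norm]
          gcongr
        _ = ε / 3 := by field_simp
    refine ⟨N, fun i hi j hj => ?_⟩
    have h1 := hb i
    have h2 := hb j
    rw [dist_comm] at h2
    have h3 := dist_triangle4 (F i x) (F i y) (F j y) (F j x)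
    linarith [hN i hi j hj]
  choose f hf using fun x => cauchySeq_tendsto_of_complete (hc x)
  refine ⟨continuousLinearMapOfTendsto F (tendsto_pi_nhds.2 hf), ?_, hf⟩
  refine ContinuousLinearMap.opNorm_le_bound _ hM fun x => ?_
  exact le_of_tendsto' (hf x).norm fun i => ContinuousLinearMap.le_of_opNorm_le _ (hF i) _

end PowerBounded

/-! ### Resolvents and Yosida approximation -/

section HilleYosida

variable {H : Type*} [NormedAddCommGroup H] [InnerProductSpace ℝ H]

/-- `R` is the resolvent of `A` at `μ`. -/
structure IsResolventAt (A : H →ₗ.[ℝ] H) (μ : ℝ) (R : H →L[ℝ] H) : Prop where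
  mem : ∀ y, R y ∈ A.domain
  smul_sub_apply : ∀ y, μ • R y - A ⟨R y, mem y⟩ = y
  apply_smul_sub : ∀ x : A.domain, R (μ • (x : H) - A x) = x

namespace IsResolventAt

variable {A : H →ₗ.[ℝ] H} {μ ν : ℝ} {R Q : H →L[ℝ] H}

theorem sub_apply (hR : IsResolventAt A μ R) (hQ : IsResolventAt A ν Q) (y : H) :
    R y - Q y = (ν - μ) • R (Q y) := by
  have h2 := hR.apply_smul_sub ⟨Q y, hQ.mem y⟩
  have h3 : y = (ν - μ) • Q y + (μ • Q y - A ⟨Q y, hQ.mem y⟩) := by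
    nth_rewrite 1 [← hQ.smul_sub_apply y]
    rw [sub_smul]
    abel
  nth_rewrite 1 [h3]
  rw [map_add, map_smul, h2, add_sub_cancel_right]

theorem commute (hR : IsResolventAt A μ R) (hQ : IsResolventAt A ν Q) : Commute R Q := by
  ext y
  have h1 := hR.sub_apply hQ y
  have h2 := hQ.sub_apply hR y
  rcases eq_or_ne μ ν with h | h
  · have : R = Q := by
      ext z
      simpa [h, sub_eq_zero] using hR.sub_apply hQ z
    rw [this]
  · have h3 : (ν - μ) • R (Q y) = (ν - μ) • Q (R y) := by
      rw [← h1, ← neg_sub μ ν, neg_smul, ← h2, neg_sub]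
    exact smul_right_injective H (sub_ne_zero.2 h.symm) h3

/-- The Yosida approximation. -/
theorem yosida_apply (hR : IsResolventAt A μ R) (x : A.domain) :
    μ • ((μ • R - 1 : H →L[ℝ] H) (x : H)) = (μ • R) (A x) := by
  have h := hR.apply_smul_sub x
  have h2 : R (A x) = μ • R x - x := by
    rw [map_sub, map_smul] at h
    rw [sub_eq_iff_eq_add] at h
    rw [h, add_sub_cancel_left]
  simp [h2]

end IsResolventAt

variable [CompleteSpace H]

/-- The **Hille–Yosida theorem** for bounded semigroups. -/
theorem exists_isInfinitesimalGenerator_of_resolvent {A : H →ₗ.[ℝ] H}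
    (hA : Dense (A.domain : Set H)) {μ : ℕ → ℝ} (hμ : ∀ k, 0 < μ k)
    (hμ' : Tendsto μ atTop atTop) {R : ℕ → H →L[ℝ] H} (hR : ∀ k, IsResolventAt A (μ k) (R k))
    {M : ℝ} (hM : ∀ k n : ℕ, ‖(μ k • R k) ^ n‖ ≤ M) :
    ∃ S : ℝ≥0 → H →L[ℝ] H, IsC0Semigroup S ∧ IsInfinitesimalGenerator A S ∧ ∀ t, ‖S t‖ ≤ M := by
  have hM0 : 0 ≤ M := (norm_nonneg _).trans (hM 0 0)
  have hJ : ∀ k, ‖μ k • R k‖ ≤ M := fun k => by simpa using hM k 1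
  -- On the domain, `μRx - x = R(Ax)` has size `O(1/μ)`; density and the uniform bound do the rest.
  have hJ1 : ∀ x, Tendsto (fun k => (μ k • R k) x) atTop (𝓝 ((1 : H →L[ℝ] H) x)) := by
    refine tendsto_apply_of_dense hJ hA fun x hx => ?_
    rw [tendsto_iff_norm_sub_tendsto_zero]
    have h0 : Tendsto (fun k => (μ k)⁻¹ * (M * ‖A ⟨x, hx⟩‖)) atTop (𝓝 0) := by
      simpa using (tendsto_inv_atTop_zero.comp hμ').mul_const (M * ‖A ⟨x, hx⟩‖)
    refine squeeze_zero (fun _ => norm_nonneg _) (fun k => ?_) h0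
    have h1 := (hR k).yosida_apply ⟨x, hx⟩
    have h2 : (μ k • R k) x - (1 : H →L[ℝ] H) x = (μ k)⁻¹ • (μ k • R k) (A ⟨x, hx⟩) := by
      rw [← h1, inv_smul_smul₀ (hμ k).ne']
      rfl
    rw [h2, norm_smul, Real.norm_of_nonneg (inv_nonneg.2 (hμ k).le)]
    gcongr
    · exact inv_nonneg.2 (hμ k).le
    · exact ContinuousLinearMap.le_of_opNorm_le _ (hJ k) _
  set Y : ℕ → H →L[ℝ] H := fun k => μ k • (μ k • R k - 1) with hY
  have hYA : ∀ x : A.domain, Tendsto (fun k => Y k x) atTop (𝓝 (A x)) := fun x => by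
    have := hJ1 (A x)
    refine this.congr fun k => ?_
    exact ((hR k).yosida_apply x).symm
  have hYM : ∀ k (t : ℝ), 0 ≤ t → ‖NormedSpace.exp (t • Y k)‖ ≤ M := fun k t ht => by
    rw [hY, smul_smul]
    exact norm_exp_smul_sub_one_le (hM k) (mul_nonneg ht (hμ k).le)
  have hRY : ∀ i j, Commute (R i) (Y j) := fun i j =>
    ((((hR i).commute (hR j)).smul_right _).sub_right (Commute.one_right _)).smul_right _
  have hYc : ∀ i j, Commute (Y i) (Y j) := fun i j =>
    (((hRY i j).smul_left _).sub_left (Commute.one_left _)).smul_left _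
  have hest : ∀ i j (t : ℝ), 0 ≤ t → ∀ x, ‖NormedSpace.exp (t • Y i) x -
      NormedSpace.exp (t • Y j) x‖ ≤ t * (M ^ 2 * ‖Y i x - Y j x‖) := fun i j t ht x =>
    norm_exp_smul_apply_sub_le (hYc i j) (hYM i) (hYM j) ht x
  have hcau : ∀ t : ℝ≥0, ∀ x ∈ (A.domain : Set H),
      CauchySeq fun k => NormedSpace.exp ((t : ℝ) • Y k) x := by
    intro t x hx
    have h1 := (hYA ⟨x, hx⟩).cauchySeq
    rw [Metric.cauchySeq_iff] at h1 ⊢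
    intro ε hε
    obtain ⟨N, hN⟩ := h1 (ε / (t * M ^ 2 + 1)) (by positivity)
    refine ⟨N, fun i hi j hj => ?_⟩
    have h2 := hN i hi j hj
    rw [lt_div_iff₀ (by positivity), dist_eq_norm] at h2
    rw [dist_eq_norm]
    refine (hest i j t t.2 x).trans_lt (lt_of_le_of_lt ?_ h2)
    have h3 := norm_nonneg (Y i x - Y j x)
    change _ ≤ ‖Y i x - Y j x‖ * _
    linarith
  choose S hSM hS using fun t : ℝ≥0 => exists_tendsto_of_dense
    (F := fun k => NormedSpace.exp ((t : ℝ) • Y k)) (fun k => hYM k t t.2) hA (hcau t)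
  have hSest : ∀ (k : ℕ) (t : ℝ≥0) (x : A.domain),
      ‖NormedSpace.exp ((t : ℝ) • Y k) (x : H) - S t x‖ ≤ t * (M ^ 2 * ‖Y k x - A x‖) := by
    intro k t x
    refine le_of_tendsto_of_tendsto' ((hS t x).const_sub _).norm
      ((((hYA x).const_sub _).norm.const_mul _).const_mul _) fun j => hest k j t t.2 x
  have hderiv : ∀ x : A.domain,
      Tendsto (fun t : ℝ≥0 => (t : ℝ)⁻¹ • (S t (x : H) - (x : H))) (𝓝[>] 0) (𝓝 (A x)) := by
    intro x
    rw [Metric.tendsto_nhds]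
    intro ε hε
    have h1 : Tendsto (fun k => (M ^ 2 + 1) * ‖Y k x - A x‖) atTop (𝓝 0) := by
      simpa using ((hYA x).sub_const (A x)).norm.const_mul (M ^ 2 + 1)
    -- Fix `k` first: the error of `Y k` in the difference quotient is bounded uniformly in `t`. The
    -- factor `M ^ 2 + 1` pays for this error and for `Y k x - A x`.
    obtain ⟨k, hk⟩ := (h1.eventually (gt_mem_nhds (half_pos hε))).exists
    have h2 : HasDerivAt (fun t : ℝ => NormedSpace.exp (t • Y k) (x : H)) (Y k x) 0 :=
      (hasDerivAt_exp_smul_const (𝕂 := ℝ) (Y k) 0).clm_apply (hasDerivAt_const _ (x : H))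
        |>.congr_deriv (by simp)
    have h3 : Tendsto (fun t : ℝ≥0 => (t : ℝ)) (𝓝[>] 0) (𝓝[>] 0) := by
      refine tendsto_nhdsWithin_iff.2 ⟨?_, ?_⟩
      · exact (NNReal.continuous_coe.tendsto' 0 0 NNReal.coe_zero).mono_left nhdsWithin_le_nhds
      · filter_upwards [self_mem_nhdsWithin] with t ht
        exact NNReal.coe_pos.2 ht
    have h4 := (h2.tendsto_slope_zero_right.comp h3)
    filter_upwards [Metric.tendsto_nhds.1 h4 (ε / 2) (half_pos hε), self_mem_nhdsWithin]
      with t ht ht0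
    have ht0' : (0 : ℝ) < t := NNReal.coe_pos.2 ht0
    rw [dist_eq_norm] at ht ⊢
    simp only [Function.comp_apply, zero_add, zero_smul, NormedSpace.exp_zero,
      one_apply_eq_self] at ht
    have h5 : ‖(t : ℝ)⁻¹ • (NormedSpace.exp ((t : ℝ) • Y k) (x : H) - S t x)‖ ≤
        M ^ 2 * ‖Y k x - A x‖ := by
      rw [norm_smul, Real.norm_of_nonneg (by positivity), inv_mul_le_iff₀ ht0']
      exact hSest k t x
    have h6 : (t : ℝ)⁻¹ • (S t (x : H) - (x : H)) - A x =
        ((t : ℝ)⁻¹ • (NormedSpace.exp ((t : ℝ) • Y k) (x : H) - (x : H)) - Y k x)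
          + (Y k x - A x)
          - (t : ℝ)⁻¹ • (NormedSpace.exp ((t : ℝ) • Y k) (x : H) - S t x) := by
      simp only [smul_sub]
      abel
    rw [h6]
    refine ((norm_sub_le _ _).trans (add_le_add_left (norm_add_le _ _) _)).trans_lt ?_
    linarith
  have hSR : ∀ (t : ℝ≥0) (k : ℕ) (x : H), S t (R k x) = R k (S t x) := by
    intro t k x
    refine tendsto_nhds_unique (hS t (R k x)) ?_
    refine (((R k).continuous.tendsto _).comp (hS t x)).congr fun j => ?_
    have hc : Commute (R k) (NormedSpace.exp ((t : ℝ) • Y j)) :=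
      ((hRY k j).smul_right _).exp_right
    exact congrArg (fun F : H →L[ℝ] H => F x) hc.eq
  have hcoe : Tendsto (fun t : ℝ≥0 => (t : ℝ)) (𝓝[>] 0) (𝓝 0) :=
    (NNReal.continuous_coe.tendsto' 0 0 NNReal.coe_zero).mono_left nhdsWithin_le_nhds
  refine ⟨S, ⟨?_, ?_, ?_⟩, ⟨hderiv, ?_⟩, hSM⟩
  · ext x
    refine tendsto_nhds_unique (hS 0 x) ?_
    simp
  · intro t s
    ext x
    refine tendsto_nhds_unique (hS (t + s) x) ?_
    refine (tendsto_apply_apply (fun k => hYM k t t.2) (hS t) (hS s x)).congr fun k => ?_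
    let _ : NormedAlgebra ℚ (H →L[ℝ] H) := NormedAlgebra.restrictScalars ℚ ℝ _
    rw [NNReal.coe_add, add_smul, NormedSpace.exp_add_of_commute
      (((Commute.refl (Y k)).smul_left _).smul_right _)]
    rfl
  · refine tendsto_apply_of_dense (G := 1) hSM hA fun x hx => ?_
    have h1 := (hcoe.smul (hderiv ⟨x, hx⟩)).add_const x
    simp only [zero_smul, zero_add] at h1
    refine h1.congr' ?_
    filter_upwards [self_mem_nhdsWithin] with t ht
    have ht0 : (t : ℝ) ≠ 0 := (NNReal.coe_pos.2 ht).ne'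
    simp [smul_inv_smul₀ ht0]
  -- Since `S` commutes with `R`, `R y = A (R x)`; hence `x = R (μ x - y)` lies in the range of `R`.
  · intro x y hxy
    have h1 := hderiv ⟨R 0 x, (hR 0).mem x⟩
    have h2 := ((R 0).continuous.tendsto _).comp hxy
    have h3 : R 0 y = A ⟨R 0 x, (hR 0).mem x⟩ := by
      refine tendsto_nhds_unique h2 (h1.congr fun t => ?_)
      simp [hSR]
    have h4 := (hR 0).smul_sub_apply x
    rw [← h3, ← map_smul, ← map_sub] at h4
    rw [← h4]
    exact (hR 0).mem _

end HilleYosida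

/-! ### Coercive weights and invertibility -/

section WeightedInner

variable {H : Type*} [NormedAddCommGroup H] [InnerProductSpace ℝ H]

namespace OpGeScalar

variable {P : H →L[ℝ] H} {c : ℝ}

theorem weightedInner_comm (hP : OpGeScalar P c) (x y : H) :
    weightedInner P x y = weightedInner P y x := by
  have h := hP.isSymmetric x y
  simp only [ContinuousLinearMap.coe_coe, sub_apply,
    smul_apply, ContinuousLinearMap.id_apply, inner_sub_left, inner_sub_right,
    real_inner_smul_left, real_inner_smul_right, sub_left_inj] at h
  rw [weightedInner, weightedInner, ← h, real_inner_comm]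

theorem mul_norm_sq_le (hP : OpGeScalar P c) (x : H) : c * ‖x‖ ^ 2 ≤ weightedInner P x x := by
  have h := hP.inner_nonneg_right x
  simp only [sub_apply, smul_apply,
    ContinuousLinearMap.id_apply, inner_sub_right, real_inner_smul_right,
    real_inner_self_eq_norm_sq, sub_nonneg] at h
  exact h

end OpGeScalar

theorem weightedInner_self_le (P : H →L[ℝ] H) (x : H) : weightedInner P x x ≤ ‖P‖ * ‖x‖ ^ 2 :=
  calc weightedInner P x x ≤ ‖x‖ * ‖P x‖ := real_inner_le_norm _ _
    _ ≤ ‖x‖ * (‖P‖ * ‖x‖) := by gcongr; exact P.le_opNorm x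
    _ = _ := by ring

/-- An operator all of whose values are contracted in the weighted norm is power bounded. -/
theorem norm_pow_le_of_weightedInner_le {P : H →L[ℝ] H} {ε : ℝ} (hε : 0 < ε)
    (hP : OpGeScalar P (ε ^ 2)) {C : H →L[ℝ] H}
    (hC : ∀ x, weightedInner P (C x) (C x) ≤ weightedInner P x x) (n : ℕ) :
    ‖C ^ n‖ ≤ √‖P‖ / ε := by
  have h : ∀ x, weightedInner P ((C ^ n) x) ((C ^ n) x) ≤ weightedInner P x x := by
    induction n with
    | zero => simp
    | succ n ih =>
      intro x
      rw [pow_succ]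
      exact (ih (C x)).trans (hC x)
  refine ContinuousLinearMap.opNorm_le_bound _ (by positivity) fun x => ?_
  rw [div_mul_eq_mul_div, le_div_iff₀ hε]
  refine (sq_le_sq₀ (by positivity) (by positivity)).1 ?_
  rw [mul_pow, mul_pow, Real.sq_sqrt (norm_nonneg _), mul_comm]
  exact (hP.mul_norm_sq_le _).trans ((h x).trans (weightedInner_self_le P x))

theorem one_le_sqrt_norm_div [Nontrivial H] {P : H →L[ℝ] H} {ε : ℝ} (hε : 0 < ε)
    (hP : OpGeScalar P (ε ^ 2)) : 1 ≤ √‖P‖ / ε := by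
  simpa using norm_pow_le_of_weightedInner_le hε hP (C := 1) (fun _ => le_rfl) 1

variable [CompleteSpace H]

theorem isUnit_of_mul_norm_sq_le_inner {K : H →L[ℝ] H} {c : ℝ} (hc : 0 < c)
    (h : ∀ x, c * ‖x‖ ^ 2 ≤ inner ℝ x (K x)) : IsUnit K := by
  refine ContinuousLinearMap.isUnit_of_forall_le_norm_inner_map K (c := ⟨c, hc.le⟩) hc fun x => ?_
  rw [mul_comm, real_inner_comm]
  exact (h x).trans (le_abs_self _)

/-- `⟨x, L L* x⟩ = ‖L* x‖²` makes `L L*` coercive, hence invertible. -/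
theorem surjective_of_adjoint_bounded_below {L : H →L[ℝ] H} {c : ℝ} (hc : 0 < c)
    (h : ∀ x, c * ‖x‖ ≤ ‖ContinuousLinearMap.adjoint L x‖) : Function.Surjective L := by
  have h1 : IsUnit (L * ContinuousLinearMap.adjoint L) := by
    refine isUnit_of_mul_norm_sq_le_inner (pow_pos hc 2) fun x => ?_
    rw [mul_apply_eq_comp, ← ContinuousLinearMap.adjoint_inner_left,
      real_inner_self_eq_norm_sq, ← mul_pow]
    exact pow_le_pow_left₀ (by positivity) (h x) 2
  intro y
  obtain ⟨x, hx⟩ := ((ContinuousLinearMap.isUnit_iff_bijective).1 h1).2 y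
  exact ⟨_, hx⟩

end WeightedInner

/-! ### Dissipative pairs `(T, 𝒜)` and invertibility of `μT - 𝒜` -/

section Dissipative

variable {H : Type*} [NormedAddCommGroup H] [InnerProductSpace ℝ H]
  {P T 𝒜 : H →L[ℝ] H} {c : ℝ}

theorem mul_weightedInner_le_of_dissipative
    (hdiss : ∀ v, weightedInner P (T v) (𝒜 v) ≤ 0) (μ : ℝ) (v : H) :
    μ * weightedInner P (T v) (T v) ≤ weightedInner P (T v) ((μ • T - 𝒜) v) := by
  have h := hdiss v
  simp only [weightedInner, sub_apply, smul_apply, map_sub,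
    map_smul, inner_sub_right, real_inner_smul_right] at h ⊢
  linarith

/-- Expand the square: the cross term `-2μ⟨Tv, 𝒜v⟩_P` and `⟨𝒜v, 𝒜v⟩_P` are nonnegative. This is the
contraction property of `μR`. -/
theorem sq_mul_weightedInner_le_of_dissipative (hc : 0 < c) (hP : OpGeScalar P c)
    (hdiss : ∀ v, weightedInner P (T v) (𝒜 v) ≤ 0) {μ : ℝ} (hμ : 0 < μ) (v : H) :
    μ ^ 2 * weightedInner P (T v) (T v) ≤
      weightedInner P ((μ • T - 𝒜) v) ((μ • T - 𝒜) v) := by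
  have h1 : 0 ≤ weightedInner P (𝒜 v) (𝒜 v) := le_trans (by positivity) (hP.mul_norm_sq_le _)
  have h2 := hP.weightedInner_comm (T v) (𝒜 v)
  have h3 := mul_nonneg hμ.le (neg_nonneg.2 (hdiss v))
  simp only [weightedInner, sub_apply, smul_apply, map_sub,
    map_smul, inner_sub_right, inner_sub_left, real_inner_smul_right,
    real_inner_smul_left] at h1 h2 h3 ⊢
  rw [← h2]
  linarith

theorem injective_smul_sub_of_dissipative (hc : 0 < c) (hP : OpGeScalar P c)
    (hT : Function.Injective T)
    (hdiss : ∀ v, weightedInner P (T v) (𝒜 v) ≤ 0) {μ : ℝ} (hμ : 0 < μ) :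
    Function.Injective (μ • T - 𝒜) := by
  refine (injective_iff_map_eq_zero _).2 fun v hv => ?_
  have h1 := sq_mul_weightedInner_le_of_dissipative hc hP hdiss hμ v
  have h2 : weightedInner P (0 : H) 0 = 0 := by simp [weightedInner]
  rw [hv, h2] at h1
  have h3 := mul_le_mul_of_nonneg_left (hP.mul_norm_sq_le (T v)) (sq_nonneg μ)
  have h4 : ‖T v‖ = 0 := by
    by_contra h
    have : 0 < μ ^ 2 * (c * ‖T v‖ ^ 2) := by positivity
    linarith
  exact hT (by rw [norm_eq_zero.1 h4, map_zero])

/-- A vector orthogonal to the range can be written `P(μT - 𝒜)v`; pairing it with `Tv` and using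
dissipativity forces `Tv = 0`. -/
theorem dense_range_of_dissipative [CompleteSpace H] (hc : 0 < c) (hP : OpGeScalar P c)
    (hT : Function.Injective T) (hdiss : ∀ v, weightedInner P (T v) (𝒜 v) ≤ 0) {μ : ℝ} (hμ : 0 < μ)
    (hsurj : Function.Surjective (μ • T - 𝒜)) : Dense (T.range : Set H) := by
  rw [Submodule.dense_iff_topologicalClosure_eq_top, Submodule.topologicalClosure_eq_top_iff,
    Submodule.eq_bot_iff]
  intro y hy
  have hPu : IsUnit P := isUnit_of_mul_norm_sq_le_inner hc hP.mul_norm_sq_le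
  obtain ⟨z, rfl⟩ := (ContinuousLinearMap.isUnit_iff_bijective.1 hPu).2 y
  obtain ⟨v, rfl⟩ := hsurj z
  have h1 : weightedInner P (T v) ((μ • T - 𝒜) v) = 0 := hy (T v) ⟨v, rfl⟩
  have h2 := mul_weightedInner_le_of_dissipative hdiss μ v
  have h3 := mul_le_mul_of_nonneg_left (hP.mul_norm_sq_le (T v)) hμ.le
  have h4 : ‖T v‖ = 0 := by
    by_contra h
    have : 0 < μ * (c * ‖T v‖ ^ 2) := by positivity
    linarith
  have h5 : v = 0 := hT (by rw [norm_eq_zero.1 h4, map_zero])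
  simp [h5]

theorem isUnit_smul_sub_of_dissipative [CompleteSpace H] (hc : 0 < c) (hP : OpGeScalar P c)
    (hT : Function.Injective T) (hdiss : ∀ v, weightedInner P (T v) (𝒜 v) ≤ 0)
    {lam : ℝ} (hlam : 0 < lam) (hsurj : Function.Surjective (lam • T - 𝒜))
    {μ : ℝ} (hμ : lam ≤ μ) : IsUnit (μ • T - 𝒜) := by
  have hL : IsUnit (lam • T - 𝒜) := ContinuousLinearMap.isUnit_iff_bijective.2
    ⟨injective_smul_sub_of_dissipative hc hP hT hdiss hlam, hsurj⟩
  obtain ⟨L, hL⟩ := hL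
  have hPu : IsUnit P := isUnit_of_mul_norm_sq_le_inner hc hP.mul_norm_sq_le
  -- `K = (μT - 𝒜)(λT - 𝒜)⁻¹`. Dissipativity makes `T(λT - 𝒜)⁻¹` monotone for `⟨·,·⟩_P`, so `PK` is
  -- coercive with no smallness condition on `μ - λ`.
  set K : H →L[ℝ] H := 1 + (μ - lam) • (T * (↑L⁻¹ : H →L[ℝ] H)) with hK
  have hPK : IsUnit (P * K) := by
    refine isUnit_of_mul_norm_sq_le_inner hc fun y => ?_
    obtain ⟨v, rfl⟩ := hsurj y
    have h1 : (↑L⁻¹ : H →L[ℝ] H) ((lam • T - 𝒜) v) = v := by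
      rw [← hL]
      exact congrArg (fun F : H →L[ℝ] H => F v) L.inv_mul
    have h2 := mul_weightedInner_le_of_dissipative hdiss lam v
    rw [hP.weightedInner_comm (T v) ((lam • T - 𝒜) v)] at h2
    have h3 : 0 ≤ weightedInner P (T v) (T v) := le_trans (by positivity) (hP.mul_norm_sq_le _)
    have h4 := mul_nonneg (sub_nonneg.2 hμ) ((mul_nonneg hlam.le h3).trans h2)
    have h5 := hP.mul_norm_sq_le ((lam • T - 𝒜) v)
    have h6 : K ((lam • T - 𝒜) v) = (lam • T - 𝒜) v + (μ - lam) • T v := by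
      rw [hK, add_apply, smul_apply,
        mul_apply_eq_comp, h1]
      rfl
    rw [mul_apply_eq_comp, h6, map_add, map_smul, inner_add_right,
      real_inner_smul_right]
    unfold weightedInner at h4 h5
    linarith
  have hKu : IsUnit K := (hPu.mul_left_iff).1 hPK
  have h : μ • T - 𝒜 = K * L := by
    rw [hK, add_mul, one_mul, smul_mul_assoc, mul_assoc, L.inv_mul, mul_one, hL, sub_smul]
    abel
  rw [h]
  exact hKu.mul L.isUnit

end Dissipative

/-! ### The operator `𝒜 T⁻¹` and exponential rescaling -/

section PieOperator

variable {H : Type*} [NormedAddCommGroup H] [InnerProductSpace ℝ H]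
  {D : Submodule ℝ H} {T : H →L[ℝ] D} {hT : Function.Bijective T} {𝒜 : H →L[ℝ] H}

theorem pieOperator_apply (v : H) (h : (T v : H) ∈ (pieOperator T hT 𝒜).domain) :
    pieOperator T hT 𝒜 ⟨T v, h⟩ = 𝒜 v :=
  congrArg 𝒜 ((LinearEquiv.ofBijective (T : H →ₗ[ℝ] D) hT).symm_apply_apply v)

theorem isResolventAt_pieOperator {μ : ℝ} {L : (H →L[ℝ] H)ˣ}
    (hL : (L : H →L[ℝ] H) = μ • D.subtypeL.comp T - 𝒜) :
    IsResolventAt (pieOperator T hT 𝒜) μ (D.subtypeL.comp T * (↑L⁻¹ : H →L[ℝ] H)) := by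
  refine ⟨fun y => (T ((↑L⁻¹ : H →L[ℝ] H) y)).2, fun y => ?_, ?_⟩
  · refine Eq.trans ?_ (congrArg (fun F : H →L[ℝ] H => F y) L.mul_inv)
    refine (congrArg (_ - ·) (pieOperator_apply ((↑L⁻¹ : H →L[ℝ] H) y) _)).trans ?_
    simp [hL]
  · rintro ⟨x, hx⟩
    obtain ⟨v, hv⟩ := hT.2 ⟨x, hx⟩
    obtain rfl : (T v : H) = x := congrArg Subtype.val hv
    rw [pieOperator_apply]
    have h1 : μ • (T v : H) - 𝒜 v = (L : H →L[ℝ] H) v := by simp [hL]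
    rw [h1]
    have h2 : (↑L⁻¹ : H →L[ℝ] H) ((L : H →L[ℝ] H) v) = v :=
      congrArg (fun F : H →L[ℝ] H => F v) L.inv_mul
    simp [h2]

theorem tendsto_coe_nhdsGT_zero : Tendsto (fun t : ℝ≥0 => (t : ℝ)) (𝓝[>] 0) (𝓝[>] 0) := by
  refine tendsto_nhdsWithin_iff.2 ⟨?_, ?_⟩
  · exact (NNReal.continuous_coe.tendsto' 0 0 NNReal.coe_zero).mono_left nhdsWithin_le_nhds
  · filter_upwards [self_mem_nhdsWithin] with t ht
    exact NNReal.coe_pos.2 ht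

theorem tendsto_exp_mul_nhdsGT_zero (ω : ℝ) :
    Tendsto (fun t : ℝ≥0 => Real.exp (ω * t)) (𝓝[>] 0) (𝓝 1) := by
  have h : Continuous fun t : ℝ => Real.exp (ω * t) := by fun_prop
  exact ((h.tendsto' 0 1 (by simp)).mono_left nhdsWithin_le_nhds).comp tendsto_coe_nhdsGT_zero

theorem IsC0Semigroup.exp_smul {S : ℝ≥0 → H →L[ℝ] H} (hS : IsC0Semigroup S) (ω : ℝ) :
    IsC0Semigroup fun t => Real.exp (ω * t) • S t := by
  refine ⟨by simp [hS.map_zero], fun t s => ?_, fun x => ?_⟩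
  · ext x
    simp [hS.map_add, mul_add, Real.exp_add, smul_smul, mul_comm]
  · simpa using (tendsto_exp_mul_nhdsGT_zero ω).smul (hS.tendsto_zero x)

/-- Rescaling a semigroup by `exp (ω t)` adds `ω x` to the derivative of the orbit of `x`. -/
theorem tendsto_exp_smul {ω : ℝ} {S : ℝ≥0 → H →L[ℝ] H} {x y : H}
    (h : Tendsto (fun t : ℝ≥0 => (t : ℝ)⁻¹ • (S t x - x)) (𝓝[>] 0) (𝓝 y)) :
    Tendsto (fun t : ℝ≥0 => (t : ℝ)⁻¹ • ((Real.exp (ω * t) • S t) x - x)) (𝓝[>] 0)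
      (𝓝 (y + ω • x)) := by
  have h1 : HasDerivAt (fun t : ℝ => Real.exp (ω * t)) ω 0 :=
    ((hasDerivAt_id (0 : ℝ)).const_mul ω).exp.congr_deriv (by simp)
  have h2 := (h1.tendsto_slope_zero_right.comp tendsto_coe_nhdsGT_zero).smul_const x
  have h3 := ((tendsto_exp_mul_nhdsGT_zero ω).smul h).add h2
  rw [one_smul] at h3
  refine h3.congr fun t => ?_
  simp only [Function.comp_apply, zero_add, mul_zero, Real.exp_zero, smul_eq_mul,
    smul_apply, smul_sub, smul_smul, mul_sub, sub_smul, mul_one]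
  rw [mul_comm (Real.exp _)]
  abel

theorem IsInfinitesimalGenerator.exp_smul_pieOperator {ω : ℝ} {S : ℝ≥0 → H →L[ℝ] H}
    (h : IsInfinitesimalGenerator (pieOperator T hT (𝒜 - ω • D.subtypeL.comp T)) S) :
    IsInfinitesimalGenerator (pieOperator T hT 𝒜) fun t => Real.exp (ω * t) • S t := by
  refine ⟨?_, fun x y hxy => ?_⟩
  · rintro ⟨x, hx⟩
    obtain ⟨v, hv⟩ := hT.2 ⟨x, hx⟩
    obtain rfl : (T v : H) = x := congrArg Subtype.val hv
    have h1 := tendsto_exp_smul (ω := ω) (h.tendsto_apply ⟨T v, hx⟩)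
    refine h1.mono_right (le_of_eq (congrArg 𝓝 ?_))
    refine (congrArg (· + ω • (T v : H)) (pieOperator_apply
      (hT := hT) (𝒜 := 𝒜 - ω • D.subtypeL.comp T) v hx)).trans
      (Eq.trans ?_ (pieOperator_apply v hx).symm)
    simp
  -- Rescaling by `exp (-ω t)` recovers `S`, whose generator has the same domain.
  · have h1 := tendsto_exp_smul (ω := -ω) hxy
    refine h.mem_domain x _ (h1.congr fun t => ?_)
    simp [smul_smul, ← Real.exp_add]

variable [CompleteSpace H]

theorem exists_isInfinitesimalGenerator_pieOperator {P : H →L[ℝ] H} {ε : ℝ} (hε : 0 < ε)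
    (hP : OpGeScalar P (ε ^ 2)) (hdiss : ∀ v, weightedInner P (T v : H) (𝒜 v) ≤ 0)
    {lam : ℝ} (hlam : 0 < lam) (hsurj : Function.Surjective (lam • D.subtypeL.comp T - 𝒜)) :
    ∃ S : ℝ≥0 → H →L[ℝ] H, IsC0Semigroup S ∧ IsInfinitesimalGenerator (pieOperator T hT 𝒜) S ∧
      ∀ t, ‖S t‖ ≤ √‖P‖ / ε := by
  have hc : 0 < ε ^ 2 := pow_pos hε 2
  have hTi : Function.Injective (D.subtypeL.comp T) := Subtype.val_injective.comp hT.1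
  have hdiss' : ∀ v, weightedInner P (D.subtypeL.comp T v) (𝒜 v) ≤ 0 := hdiss
  have hu : ∀ k : ℕ, IsUnit ((lam + k) • D.subtypeL.comp T - 𝒜) := fun k =>
    isUnit_smul_sub_of_dissipative hc hP hTi hdiss' hlam hsurj (by simp)
  choose L hL using hu
  have hμ : ∀ k : ℕ, 0 < lam + k := fun k => by positivity
  have hrange : (D.subtypeL.comp T).range = D := by
    ext x
    refine ⟨?_, fun hx => ?_⟩
    · rintro ⟨v, rfl⟩
      exact (T v).2
    · obtain ⟨v, hv⟩ := hT.2 ⟨x, hx⟩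
      exact ⟨v, congrArg Subtype.val hv⟩
  have hdense := dense_range_of_dissipative hc hP hTi hdiss' hlam hsurj
  rw [hrange] at hdense
  refine exists_isInfinitesimalGenerator_of_resolvent (A := pieOperator T hT 𝒜) hdense hμ
    (tendsto_atTop_add_const_left _ _ tendsto_natCast_atTop_atTop)
    (fun k => isResolventAt_pieOperator (hL k)) fun k n => ?_
  refine norm_pow_le_of_weightedInner_le hε hP (fun x => ?_) n
  have h1 := sq_mul_weightedInner_le_of_dissipative hc hP hdiss' (hμ k)
    ((↑(L k)⁻¹ : H →L[ℝ] H) x)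
  have h2 : ((lam + k) • D.subtypeL.comp T - 𝒜) ((↑(L k)⁻¹ : H →L[ℝ] H) x) = x := by
    rw [← hL]
    exact congrArg (fun F : H →L[ℝ] H => F x) (L k).mul_inv
  rw [h2] at h1
  refine le_of_eq_of_le ?_ h1
  simp only [weightedInner, smul_apply, mul_apply_eq_comp, map_smul,
    real_inner_smul_left, real_inner_smul_right]
  ring

end PieOperator

/-- Needed for `M ≥ 1`: on the zero space `‖P‖ = 0`. -/
theorem nontrivial_L2 {n : ℕ} (hn : 1 ≤ n) {a b : ℝ} (hab : a < b) : Nontrivial (L2 n a b) := by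
  have : NeZero n := ⟨by omega⟩
  have hfin : ((volume : Measure ℝ).restrict (Set.Icc a b)) Set.univ ≠ ⊤ := by simp
  have hpos : ((volume : Measure ℝ).restrict (Set.Icc a b)) Set.univ ≠ 0 := by simp [hab]
  obtain ⟨c, hc⟩ := exists_ne (0 : EuclideanSpace ℝ (Fin n))
  refine ⟨indicatorConstLp 2 MeasurableSet.univ hfin c, 0, fun h => ?_⟩
  have h1 := norm_indicatorConstLp (c := c) (hs := MeasurableSet.univ) (hμs := hfin)
    (p := 2) two_ne_zero ENNReal.ofNat_ne_top
  rw [h, norm_zero] at h1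
  have h2 : 0 < ((volume : Measure ℝ).restrict (Set.Icc a b)).real Set.univ :=
    ENNReal.toReal_pos hpos hfin
  have h3 := norm_pos_iff.2 hc
  have : 0 < ‖c‖ * ((volume : Measure ℝ).restrict (Set.Icc a b)).real Set.univ
    ^ (1 / (2 : ENNReal).toReal) := by positivity
  exact this.ne h1

theorem mainTheorem2 (n : ℕ) (hn : 1 ≤ n) (a b : ℝ) (hab : a < b)
    (D : Submodule ℝ (L2 n a b))
    (T : L2 n a b →L[ℝ] D) (hT : Function.Bijective T)
    (𝒜 : L2 n a b →L[ℝ] L2 n a b) (ω : ℝ)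
    (ε₁ : ℝ) (hε₁ : 0 < ε₁) (P : L2 n a b →L[ℝ] L2 n a b)
    (hP : OpGeScalar P (ε₁ ^ 2))
    (hdiss : ∀ v : L2 n a b,
      weightedInner P (T v : L2 n a b) (𝒜 v)
        ≤ ω * weightedInner P (T v : L2 n a b) (T v : L2 n a b))
    (hsurj : ∃ ε₂ : ℝ, 0 < ε₂ ∧ ∃ lam : ℝ, ω < lam ∧ ∀ v : L2 n a b,
      ε₂ * ‖v‖ ≤
        ‖(lam • ContinuousLinearMap.adjoint (D.subtypeL.comp T)
            - ContinuousLinearMap.adjoint 𝒜) v‖) :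
    ∃ S : ℝ≥0 → L2 n a b →L[ℝ] L2 n a b,
      IsC0Semigroup S ∧
      IsInfinitesimalGenerator (pieOperator T hT 𝒜) S ∧
      HasGrowthRateGain S ω (Real.sqrt ‖P‖ / ε₁) := by
  obtain ⟨ε₂, hε₂, lam, hlam, hbelow⟩ := hsurj
  have := nontrivial_L2 hn hab
  -- The shift by `ω` cancels, so the adjoint bound at `λ` serves the shifted problem at `λ - ω >
  -- 0`.
  have hshift : (lam - ω) • D.subtypeL.comp T - (𝒜 - ω • D.subtypeL.comp T) =
      lam • D.subtypeL.comp T - 𝒜 := by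
    rw [sub_smul]
    abel
  have hsurj : Function.Surjective
      ((lam - ω) • D.subtypeL.comp T - (𝒜 - ω • D.subtypeL.comp T)) := by
    refine surjective_of_adjoint_bounded_below hε₂ fun v => ?_
    rw [hshift, map_sub, map_smulₛₗ]
    exact hbelow v
  have hdiss' : ∀ v, weightedInner P (T v : L2 n a b) ((𝒜 - ω • D.subtypeL.comp T) v) ≤ 0 := by
    intro v
    have h := hdiss v
    simp only [weightedInner, sub_apply, smul_apply,
      ContinuousLinearMap.comp_apply, Submodule.subtypeL_apply, map_sub, map_smul, inner_sub_right,
      real_inner_smul_right] at h ⊢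
    linarith
  obtain ⟨S, hS, hgen, hbound⟩ := exists_isInfinitesimalGenerator_pieOperator (hT := hT) hε₁ hP
    hdiss' (sub_pos.2 hlam) hsurj
  refine ⟨_, hS.exp_smul ω, hgen.exp_smul_pieOperator, one_le_sqrt_norm_div hε₁ hP, fun t => ?_⟩
  rw [norm_smul, Real.norm_of_nonneg (Real.exp_nonneg _), mul_comm]
  gcongr
  exact hbound t
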